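/- For $\alpha,\beta>-1$ and an integer $n\ge 0$ let $P_n^{(\alpha,\beta)}$ be the $n$-th monic Jacobi polynomial, i.e. the monic polynomial of degree $n$ that is orthogonal on $[-1,1]$, with respect to the weight $(1-x)^{\alpha}(1+x)^{\beta}$, to all polynomials of degree less than $n$. Put $$\lambda_n=\lambda_n(\alpha,\beta)=\int_{-1}^{1}\frac{P_n^{(\alpha+1,\beta+1)}(s)}{3-s}\,(1-s)^{\alpha+1}(1+s)^{\beta+1}\,ds ,\qquad n\ge 0,$$ and, for $x\neq y$ and $j\ge 0$, $$K_j^{(\alpha,\beta)}(x,y)=\frac{P_{j+1}^{(\alpha,\beta)}(x)\,P_j^{(\alpha,\beta)}(y)-P_{j+1}^{(\alpha,\beta)}(y)\,P_j^{(\alpha,\beta)}(x)}{x-y}.$$ For functions $F,G$ that are real-analytic near an interval $\gamma\subset\mathbb R$, let $z_1,\dots,z_k$ and $w_1,\dots,w_m$ be the zeros of $F$ and of $G$ in $\gamma$, counted with multiplicity. Write $F\prec G$ in $\gamma$ if, for a suitable numbering, either $m=k$ and $z_1<w_1<z_2<w_2<\dots<z_k<w_k$, or $m=k-1$ and $z_1<w_1<z_2<\dots<z_{k-1}<w_{k-1}<z_k$.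 Then: 1. For all $\alpha,\beta>0$ and $n\ge 0$, the polynomial $S_n(x)=K_{n+1}^{(\alpha-1,\beta-1)}(x,3)$ satisfies $S_n\prec P_n^{(\alpha,\beta)}$ in $[-1,1]$. 2. For all $\alpha,\beta>-1$ and $n\ge 2$, the polynomial $R_{n-1}(x)=\lambda_{n-2}\,P_{n-1}^{(\alpha+1,\beta+1)}(x)-\lambda_{n-1}\,P_{n-2}^{(\alpha+1,\beta+1)}(x)$ satisfies $P_n^{(\alpha,\beta)}\prec R_{n-1}$ in $[-1,1]$. -/

import Mathlib

open Polynomial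

/-- The Jacobi weight `(1 - x)^α (1 + x)^β`, considered on `[-1, 1]`. -/
noncomputable def jacobiWeight (α β x : ℝ) : ℝ := (1 - x) ^ α * (1 + x) ^ β

/-- The inner product `∫_{-1}^{1} p(x) q(x) (1 - x)^α (1 + x)^β dx` of two real polynomials. -/
noncomputable def jacobiInner (α β : ℝ) (p q : ℝ[X]) : ℝ :=
  ∫ x in (-1 : ℝ)..1, p.eval x * q.eval x * jacobiWeight α β x

/-- The `n`-th monic Jacobi polynomial `P_n^{(α,β)}`, that is the monic polynomial of degree `n`
orthogonal on `[-1, 1]` to all polynomials of smaller degree with respect to the Jacobi weight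
(`α, β > -1`). It is built by orthogonalizing `1, X, X^2, …`; its defining property is proved
in `jacobiP_spec`, and uniqueness in `jacobiP_unique`. -/
noncomputable def jacobiP (α β : ℝ) (n : ℕ) : ℝ[X] :=
  X ^ n - ∑ k : Fin n,
    C (jacobiInner α β (X ^ n) (jacobiP α β k) /
        jacobiInner α β (jacobiP α β k) (jacobiP α β k)) * jacobiP α β k
termination_by n
decreasing_by all_goals exact k.2

theorem jacobiP_eq (α β : ℝ) (n : ℕ) :
    jacobiP α β n = X ^ n - ∑ k ∈ Finset.range n,
      C (jacobiInner α β (X ^ n) (jacobiP α β k) /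
          jacobiInner α β (jacobiP α β k) (jacobiP α β k)) * jacobiP α β k := by
  rw [jacobiP, Finset.sum_range]

theorem jacobiP_monic_natDegree (α β : ℝ) (n : ℕ) :
    (jacobiP α β n).Monic ∧ (jacobiP α β n).natDegree = n := by
  induction n using Nat.strong_induction_on with
  | _ n ih =>
    have hdeg : (∑ k ∈ Finset.range n,
        C (jacobiInner α β (X ^ n) (jacobiP α β k) /
          jacobiInner α β (jacobiP α β k) (jacobiP α β k)) * jacobiP α β k).degree
        < ((n : ℕ) : WithBot ℕ) := by
      refine (Finset.sum_induction _ (fun p : ℝ[X] => p.degree < ((n : ℕ) : WithBot ℕ)) ?_ ?_ ?_)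
      · intro a b ha hb
        exact lt_of_le_of_lt (degree_add_le _ _) (max_lt ha hb)
      · simp
      · intro k hk
        have hk' := Finset.mem_range.1 hk
        refine lt_of_le_of_lt (degree_mul_le _ _) ?_
        refine lt_of_le_of_lt (add_le_add_left degree_C_le _) ?_
        rw [zero_add, degree_eq_natDegree (ih k hk').1.ne_zero, (ih k hk').2]
        exact_mod_cast hk'
    have hm : (jacobiP α β n).Monic := by
      rw [jacobiP_eq]
      exact monic_X_pow_sub hdeg
    refine ⟨hm, ?_⟩
    rw [jacobiP_eq]
    apply natDegree_eq_of_degree_eq_some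
    rw [degree_sub_eq_left_of_degree_lt (by rwa [degree_X_pow]), degree_X_pow]

theorem jacobiWeight_intervalIntegrable {α β : ℝ} (hα : -1 < α) (hβ : -1 < β) :
    IntervalIntegrable (jacobiWeight α β) MeasureTheory.volume (-1) 1 := by
  have h1 : IntervalIntegrable (fun x : ℝ => (1 + x) ^ β) MeasureTheory.volume (-1) 0 := by
    have := (intervalIntegral.intervalIntegrable_rpow' (a := 0) (b := 1) hβ).comp_add_left 1
    simpa using this
  have h2 : IntervalIntegrable (fun x : ℝ => (1 - x) ^ α) MeasureTheory.volume 0 1 := by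
    have := (intervalIntegral.intervalIntegrable_rpow' (a := 1) (b := 0) hα).comp_sub_left 1
    simpa using this
  refine IntervalIntegrable.trans (b := 0) ?_ ?_
  · refine h1.continuousOn_mul ?_
    intro x hx
    rw [Set.uIcc_of_le (by norm_num)] at hx
    exact (ContinuousAt.rpow_const (by fun_prop)
      (Or.inl (by linarith [hx.2]))).continuousWithinAt
  · refine h2.mul_continuousOn ?_
    intro x hx
    rw [Set.uIcc_of_le (by norm_num)] at hx
    exact (ContinuousAt.rpow_const (by fun_prop)
      (Or.inl (by linarith [hx.1]))).continuousWithinAt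

theorem jacobiInner_integrable {α β : ℝ} (hα : -1 < α) (hβ : -1 < β) (p q : ℝ[X]) :
    IntervalIntegrable (fun x => p.eval x * q.eval x * jacobiWeight α β x)
      MeasureTheory.volume (-1) 1 :=
  (jacobiWeight_intervalIntegrable hα hβ).continuousOn_mul
    ((p.continuous.mul q.continuous).continuousOn)

theorem jacobiInner_comm (α β : ℝ) (p q : ℝ[X]) :
    jacobiInner α β p q = jacobiInner α β q p := by
  simp only [jacobiInner, mul_comm (p.eval _)]

theorem jacobiInner_add {α β : ℝ} (hα : -1 < α) (hβ : -1 < β) (p q r : ℝ[X]) :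
    jacobiInner α β (p + q) r = jacobiInner α β p r + jacobiInner α β q r := by
  unfold jacobiInner
  rw [← intervalIntegral.integral_add (jacobiInner_integrable hα hβ p r)
    (jacobiInner_integrable hα hβ q r)]
  simp only [eval_add, add_mul]

theorem jacobiInner_C_mul (α β c : ℝ) (p r : ℝ[X]) :
    jacobiInner α β (C c * p) r = c * jacobiInner α β p r := by
  unfold jacobiInner
  rw [← intervalIntegral.integral_const_mul]
  simp only [eval_mul, eval_C, mul_assoc]

theorem jacobiInner_sub {α β : ℝ} (hα : -1 < α) (hβ : -1 < β) (p q r : ℝ[X]) :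
    jacobiInner α β (p - q) r = jacobiInner α β p r - jacobiInner α β q r := by
  have h := jacobiInner_add hα hβ (p - q) q r
  rw [sub_add_cancel] at h
  linarith

theorem jacobiInner_sum {α β : ℝ} (hα : -1 < α) (hβ : -1 < β) (s : Finset ℕ)
    (f : ℕ → ℝ[X]) (r : ℝ[X]) :
    jacobiInner α β (∑ k ∈ s, f k) r = ∑ k ∈ s, jacobiInner α β (f k) r := by
  induction s using Finset.induction_on with
  | empty => simp [jacobiInner]
  | insert a s ha ih => rw [Finset.sum_insert ha, Finset.sum_insert ha, jacobiInner_add hα hβ, ih]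

theorem jacobiInner_self_pos {α β : ℝ} (hα : -1 < α) (hβ : -1 < β) {p : ℝ[X]} (hp : p ≠ 0) :
    0 < jacobiInner α β p p := by
  have hw : ∀ x ∈ Set.Ioo (-1 : ℝ) 1, 0 < jacobiWeight α β x := fun x hx =>
    mul_pos (Real.rpow_pos_of_pos (by linarith [hx.2]) _)
      (Real.rpow_pos_of_pos (by linarith [hx.1]) _)
  unfold jacobiInner
  rw [intervalIntegral.integral_pos_iff_support_of_nonneg_ae' ?_ (jacobiInner_integrable hα hβ p p)]
  · refine ⟨by norm_num, ?_⟩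
    have hsub : Set.Ioo (-1 : ℝ) 1 \ (p.roots.toFinset : Set ℝ) ⊆
        Function.support (fun x => p.eval x * p.eval x * jacobiWeight α β x) ∩ Set.Ioc (-1) 1 := by
      rintro x ⟨hx, hr⟩
      have hpx : p.eval x ≠ 0 := by
        intro h
        exact hr (by simpa [hp] using h)
      exact ⟨mul_ne_zero (mul_ne_zero hpx hpx) (hw x hx).ne', hx.1, hx.2.le⟩
    refine lt_of_lt_of_le ?_ (MeasureTheory.measure_mono hsub)
    rw [MeasureTheory.measure_sdiff_null (Finset.measure_zero _ _)]
    simp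
  · rw [Set.uIoc_of_le (by norm_num)]
    refine (MeasureTheory.ae_restrict_iff' measurableSet_Ioc).2 (Filter.Eventually.of_forall ?_)
    intro x hx
    exact mul_nonneg (mul_self_nonneg _) (mul_nonneg (Real.rpow_nonneg (by linarith [hx.2]) _)
      (Real.rpow_nonneg (by linarith [hx.1]) _))

theorem jacobiP_orthogonal_of_lt {α β : ℝ} (hα : -1 < α) (hβ : -1 < β) (n : ℕ) :
    ∀ m < n, jacobiInner α β (jacobiP α β n) (jacobiP α β m) = 0 := by
  induction n using Nat.strong_induction_on with
  | _ n ih =>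
    intro m hm
    have hpos := jacobiInner_self_pos hα hβ (jacobiP_monic_natDegree α β m).1.ne_zero
    rw [jacobiP_eq α β n, jacobiInner_sub hα hβ, jacobiInner_sum hα hβ,
      Finset.sum_eq_single_of_mem m (Finset.mem_range.2 hm)]
    · rw [jacobiInner_C_mul, div_mul_cancel₀ _ hpos.ne', sub_self]
    · intro k hk hkm
      rw [jacobiInner_C_mul]
      rcases lt_or_gt_of_ne hkm with h | h
      · rw [jacobiInner_comm α β (jacobiP α β k) (jacobiP α β m), ih m hm k h, mul_zero]
      · rw [ih k (Finset.mem_range.1 hk) m h, mul_zero]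

/-- For `α, β > -1`, `jacobiP α β n` is monic of degree `n` and orthogonal to all polynomials of
degree less than `n` with respect to the Jacobi weight. -/
theorem jacobiP_spec {α β : ℝ} (hα : -1 < α) (hβ : -1 < β) (n : ℕ) :
    (jacobiP α β n).Monic ∧ (jacobiP α β n).natDegree = n ∧
      ∀ q : ℝ[X], q.degree < n → jacobiInner α β (jacobiP α β n) q = 0 := by
  refine ⟨(jacobiP_monic_natDegree α β n).1, (jacobiP_monic_natDegree α β n).2, ?_⟩
  have key : ∀ m ≤ n, ∀ q : ℝ[X], q.degree < m → jacobiInner α β (jacobiP α β n) q = 0 := by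
    intro m
    induction m with
    | zero =>
      intro _ q hq
      have : q = 0 := by
        rw [← degree_eq_bot]
        exact Nat.WithBot.lt_zero_iff.1 (by exact_mod_cast hq)
      simp [this, jacobiInner]
    | succ m ih =>
      intro hm q hq
      have hJ := jacobiP_monic_natDegree α β m
      have hr : (q - C (q.coeff m) * jacobiP α β m).degree < m := by
        rw [degree_lt_iff_coeff_zero]
        intro k hk
        rcases hk.eq_or_lt with rfl | hk
        · have : (jacobiP α β m).coeff m = 1 := by
            have := hJ.1.coeff_natDegree
            rwa [hJ.2] at this
          simp [this]
        · have h1 : q.coeff k = 0 := coeff_eq_zero_of_degree_lt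
            (lt_of_lt_of_le hq (by exact_mod_cast hk))
          have h2 : (jacobiP α β m).coeff k = 0 :=
            coeff_eq_zero_of_natDegree_lt (by rw [hJ.2]; exact hk)
          simp [h1, h2]
      have h0 := ih (by omega) _ hr
      rw [jacobiInner_comm, jacobiInner_sub hα hβ, jacobiInner_C_mul,
        jacobiInner_comm α β (jacobiP α β m),
        jacobiP_orthogonal_of_lt hα hβ n m (by omega), mul_zero, sub_zero] at h0
      rw [jacobiInner_comm, h0]
  exact key n le_rfl

/-- The property in `jacobiP_spec` determines the monic Jacobi polynomial. -/
theorem jacobiP_unique {α β : ℝ} (hα : -1 < α) (hβ : -1 < β) (n : ℕ) (p : ℝ[X]) (hp : p.Monic)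
    (hn : p.natDegree = n) (ho : ∀ q : ℝ[X], q.degree < n → jacobiInner α β p q = 0) :
    p = jacobiP α β n := by
  obtain ⟨hm, hd, hJ⟩ := jacobiP_spec hα hβ n
  by_contra hne
  have hlt : (p - jacobiP α β n).degree < n := by
    have h := degree_sub_lt_left (p := p) (q := jacobiP α β n)
      (by rw [degree_eq_natDegree hp.ne_zero, degree_eq_natDegree hm.ne_zero, hn, hd])
      hp.ne_zero (by rw [hp.leadingCoeff, hm.leadingCoeff])
    rwa [degree_eq_natDegree hp.ne_zero, hn] at h
  have hpos := jacobiInner_self_pos hα hβ (sub_ne_zero.2 hne)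
  rw [jacobiInner_sub hα hβ, ho _ hlt, hJ _ hlt, sub_zero] at hpos
  exact lt_irrefl _ hpos

/-- `λ_n(α, β) = ∫_{-1}^{1} P_n^{(α+1,β+1)}(s) / (3 - s) (1 - s)^(α+1) (1 + s)^(β+1) ds`. -/
noncomputable def jacobiLam (α β : ℝ) (n : ℕ) : ℝ :=
  ∫ s in (-1 : ℝ)..1, (jacobiP (α + 1) (β + 1) n).eval s / (3 - s) *
    (1 - s) ^ (α + 1) * (1 + s) ^ (β + 1)

/-- The (scaled) Christoffel–Darboux kernel `K_j^{(α,β)}(x, y)`, for `x ≠ y`. -/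
noncomputable def jacobiK (α β : ℝ) (j : ℕ) (x y : ℝ) : ℝ :=
  ((jacobiP α β (j + 1)).eval x * (jacobiP α β j).eval y -
    (jacobiP α β (j + 1)).eval y * (jacobiP α β j).eval x) / (x - y)

/-- `R_k = λ_{k-1} P_k^{(α+1,β+1)} - λ_k P_{k-1}^{(α+1,β+1)}`, for `k ≥ 1`. -/
noncomputable def jacobiR (α β : ℝ) (k : ℕ) (x : ℝ) : ℝ :=
  (jacobiP (α + 1) (β + 1) k).eval x * jacobiLam α β (k - 1) -
    (jacobiP (α + 1) (β + 1) (k - 1)).eval x * jacobiLam α β k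

/-- `S_n(x) = K_{n+1}^{(α-1,β-1)}(x, 3)`. -/
noncomputable def jacobiS (α β : ℝ) (n : ℕ) (x : ℝ) : ℝ :=
  jacobiK (α - 1) (β - 1) (n + 1) x 3

/-- `F` is real-analytic on a neighbourhood of `γ ⊆ ℝ`, and `z` lists the zeros of `F` in `γ`, each
repeated according to its multiplicity. -/
def ListsZeros (F : ℝ → ℝ) (γ : Set ℝ) {n : ℕ} (z : Fin n → ℝ) : Prop :=
  AnalyticOnNhd ℝ F γ ∧ (∀ i, z i ∈ γ) ∧
    ∀ x ∈ γ, analyticOrderAt F x = ({i | z i = x}.ncard : ℕ∞)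

/-- Strict interlacing `F ≺ G` in `γ ⊆ ℝ`: the zeros `z` of `F` and `w` of `G` in `γ`, counted with
multiplicity, satisfy either `z₁ < w₁ < z₂ < w₂ < ⋯ < zₙ < wₙ` (equally many zeros), or
`z₁ < w₁ < z₂ < ⋯ < wₙ₋₁ < zₙ` (`G` has one zero less). -/
def StrictlyInterlaces (F G : ℝ → ℝ) (γ : Set ℝ) : Prop :=
  (∃ (n : ℕ) (z w : Fin n → ℝ), ListsZeros F γ z ∧ ListsZeros G γ w ∧
    (∀ i, z i < w i) ∧ ∀ (i : ℕ) (h : i + 1 < n), w ⟨i, by omega⟩ < z ⟨i + 1, h⟩) ∨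
  (∃ (m : ℕ) (z : Fin (m + 1) → ℝ) (w : Fin m → ℝ), ListsZeros F γ z ∧ ListsZeros G γ w ∧
    ∀ i : Fin m, z i.castSucc < w i ∧ w i < z i.succ)

/-! Both claims are instances of one statement about a positive functional `M` on polynomials over
[-1, 1]. Let p be monic of degree m + 1 and orthogonal for (3 - x)M, and q monic of degree m and
orthogonal for N = (1 - x²)M. Then p ≺ q (`strictlyInterlaces_of_orthogonal`).

Both p and q have simple zeros, all in (-1, 1). For a zero w of q put l = q/(x - w); the core is
p(w) l(w) < 0 (`eval_mul_eval_neg`), obtained by computing N(pl) twice. Orthogonality of p gives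
M(pg) = g(3) M(p) for deg g ≤ deg p, with M(p) > 0; since 1 - x² = (3 - x)(x + 3) - 8, this yields
N(pl) = -8 l(3) M(p) < 0. Dividing p by x - w gives N(pl) = N(q²) + p(w) N(l), so p(w) N(l) < 0;
finally l(w) N(l) = N(l²) > 0. As l(w) = q'(w), counting signs forces interlacing
(`interlace_of_prod_neg`).

For claim 1, M is the weight with parameters (α - 1, β - 1), q is the Jacobi polynomial, and p is
the kernel at 3 up to a constant. For claim 2, M is the weight with parameters (α, β) divided by 3 -
x, p is the Jacobi polynomial, and q is R up to a constant. -/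

/-! ### Positive functionals and zeros of orthogonal polynomials -/

/-- A linear functional on real polynomials is positive on `[-1, 1]` if it is positive at every
nonzero polynomial that is nonnegative on `[-1, 1]`. -/
def PositiveFunctional (L : ℝ[X] →ₗ[ℝ] ℝ) : Prop :=
  ∀ f : ℝ[X], f ≠ 0 → (∀ x ∈ Set.Icc (-1 : ℝ) 1, 0 ≤ f.eval x) → 0 < L f

/-- `p` is orthogonal with respect to `L` to all polynomials of smaller degree. -/
def OrthogonalFor (L : ℝ[X] →ₗ[ℝ] ℝ) (p : ℝ[X]) : Prop :=
  ∀ g : ℝ[X], g.degree < p.degree → L (p * g) = 0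

/-- The functional `f ↦ L (h * f)`. -/
noncomputable def weightedFunctional (L : ℝ[X] →ₗ[ℝ] ℝ) (h : ℝ[X]) : ℝ[X] →ₗ[ℝ] ℝ :=
  L ∘ₗ LinearMap.mulLeft ℝ h

@[simp]
theorem weightedFunctional_apply (L : ℝ[X] →ₗ[ℝ] ℝ) (h f : ℝ[X]) :
    weightedFunctional L h f = L (h * f) := rfl

theorem PositiveFunctional.weighted {L : ℝ[X] →ₗ[ℝ] ℝ} (hL : PositiveFunctional L) {h : ℝ[X]}
    (h0 : h ≠ 0) (hh : ∀ x ∈ Set.Icc (-1 : ℝ) 1, 0 ≤ h.eval x) :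
    PositiveFunctional (weightedFunctional L h) := by
  intro f hf hf'
  refine hL _ (mul_ne_zero h0 hf) fun x hx => ?_
  rw [LinearMap.mulLeft_apply, eval_mul]
  exact mul_nonneg (hh x hx) (hf' x hx)

theorem PositiveFunctional.self_pos {L : ℝ[X] →ₗ[ℝ] ℝ} (hL : PositiveFunctional L) {g : ℝ[X]}
    (hg : g ≠ 0) : 0 < L (g * g) :=
  hL _ (mul_ne_zero hg hg) fun x _ => by rw [eval_mul]; exact mul_self_nonneg _

/-- The product is p * g with deg g < deg p. As g * g ≥ 0, a factor f of constant sign on [-1, 1]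
would contradict this. -/
theorem OrthogonalFor.factor {L : ℝ[X] →ₗ[ℝ] ℝ} {p f g : ℝ[X]} (ho : OrthogonalFor L p)
    (hp : p ≠ 0) (hfg : p = f * g) (hf : 0 < f.natDegree) : L (f * (g * g)) = 0 := by
  have hf0 : f ≠ 0 := fun h => hp (by rw [hfg, h, zero_mul])
  have hg0 : g ≠ 0 := fun h => hp (by rw [hfg, h, mul_zero])
  rw [← mul_assoc, ← hfg]
  apply ho
  rw [degree_eq_natDegree hp, degree_eq_natDegree hg0, hfg, natDegree_mul hf0 hg0]
  exact_mod_cast (by omega : g.natDegree < f.natDegree + g.natDegree)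

/-- A factor of positive degree of an orthogonal polynomial changes sign on `[-1, 1]`. -/
theorem OrthogonalFor.exists_neg {L : ℝ[X] →ₗ[ℝ] ℝ} (hL : PositiveFunctional L) {p f : ℝ[X]}
    (ho : OrthogonalFor L p) (hp : p ≠ 0) (hfp : f ∣ p) (hf : 0 < f.natDegree) :
    ∃ x ∈ Set.Icc (-1 : ℝ) 1, f.eval x < 0 := by
  obtain ⟨g, hg⟩ := hfp
  by_contra! H
  have hg0 : g ≠ 0 := fun h => hp (by rw [hg, h, mul_zero])
  have hf0 : f ≠ 0 := fun h => hp (by rw [hg, h, zero_mul])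
  have h := hL (f * (g * g)) (mul_ne_zero hf0 (mul_ne_zero hg0 hg0)) fun x hx => by
    rw [eval_mul, eval_mul]
    exact mul_nonneg (H x hx) (mul_self_nonneg _)
  rw [ho.factor hp hg hf] at h
  exact lt_irrefl _ h

theorem OrthogonalFor.root_mem {L : ℝ[X] →ₗ[ℝ] ℝ} (hL : PositiveFunctional L) {p : ℝ[X]}
    (ho : OrthogonalFor L p) (hp : p ≠ 0) {a : ℝ} (ha : p.IsRoot a) :
    a ∈ Set.Ioo (-1 : ℝ) 1 := by
  have hd : X - C a ∣ p := dvd_iff_isRoot.2 ha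
  obtain ⟨x, hx, h1⟩ := ho.exists_neg hL hp hd (by rw [natDegree_X_sub_C]; norm_num)
  obtain ⟨y, hy, h2⟩ := ho.exists_neg hL hp (neg_dvd.2 hd)
    (by rw [natDegree_neg, natDegree_X_sub_C]; norm_num)
  simp only [eval_neg, eval_sub, eval_X, eval_C] at h1 h2
  exact ⟨by linarith [hx.1], by linarith [hy.2]⟩

theorem OrthogonalFor.squarefree_roots {L : ℝ[X] →ₗ[ℝ] ℝ} (hL : PositiveFunctional L) {p : ℝ[X]}
    (ho : OrthogonalFor L p) (hp : p ≠ 0) : p.roots.Nodup := by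
  rw [Multiset.nodup_iff_count_le_one]
  intro a
  rw [count_roots]
  by_contra! H
  have hd : (X - C a) ^ 2 ∣ p := (le_rootMultiplicity_iff hp).1 H
  obtain ⟨x, -, h1⟩ := ho.exists_neg hL hp hd (by rw [natDegree_pow, natDegree_X_sub_C]; norm_num)
  rw [eval_pow] at h1
  exact absurd h1 (not_lt.2 (sq_nonneg _))

/-- An irreducible factor and its negative both take negative values, so the factor has a real zero
and is linear. -/
theorem OrthogonalFor.splits {L : ℝ[X] →ₗ[ℝ] ℝ} (hL : PositiveFunctional L) {p : ℝ[X]}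
    (ho : OrthogonalFor L p) (hp : p ≠ 0) : p.Splits := by
  obtain ⟨u, hu⟩ := UniqueFactorizationMonoid.factors_prod hp
  rw [← hu]
  refine (Splits.multisetProd fun g hg' => ?_).mul u.isUnit.splits
  have hg := UniqueFactorizationMonoid.irreducible_of_factor g hg'
  have hgp := UniqueFactorizationMonoid.dvd_of_mem_factors hg'
  have hgd := hg.natDegree_pos
  obtain ⟨x, hx, h1⟩ := ho.exists_neg hL hp hgp hgd
  obtain ⟨y, hy, h2⟩ := ho.exists_neg hL hp (neg_dvd.2 hgp) (by rwa [natDegree_neg])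
  rw [eval_neg, neg_lt_zero] at h2
  obtain ⟨c, hc⟩ : ∃ c, g.eval c = 0 := by
    have := mem_range_of_exists_le_of_exists_ge g.continuous ⟨x, h1.le⟩ ⟨y, h2.le⟩
    exact this
  exact Splits.of_degree_eq_one (degree_eq_one_of_irreducible_of_root hg hc)

/-- A monic orthogonal polynomial has simple real zeros, all in `(-1, 1)`. -/
theorem OrthogonalFor.exists_roots {L : ℝ[X] →ₗ[ℝ] ℝ} (hL : PositiveFunctional L) {p : ℝ[X]}
    (ho : OrthogonalFor L p) (hp : p.Monic) {n : ℕ} (hn : p.natDegree = n) :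
    ∃ z : Fin n → ℝ, StrictMono z ∧ (∀ i, z i ∈ Set.Ioo (-1 : ℝ) 1) ∧ p = ∏ i, (X - C (z i)) := by
  have hs := ho.splits hL hp.ne_zero
  have hnd := ho.squarefree_roots hL hp.ne_zero
  have hcard : p.roots.toFinset.card = n := by
    rw [Multiset.toFinset_card_of_nodup hnd, ← hs.natDegree_eq_card_roots, hn]
  refine ⟨p.roots.toFinset.orderEmbOfFin hcard, OrderEmbedding.strictMono _, fun i => ?_, ?_⟩
  · have := p.roots.toFinset.orderEmbOfFin_mem hcard i
    exact ho.root_mem hL hp.ne_zero (isRoot_of_mem_roots (Multiset.mem_toFinset.1 this))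
  · have h1 := Finset.prod_map Finset.univ (p.roots.toFinset.orderEmbOfFin hcard).toEmbedding
      (fun a => X - C a)
    rw [Finset.map_orderEmbOfFin_univ] at h1
    conv_lhs => rw [hs.eq_prod_roots_of_monic hp]
    rw [Finset.prod, Multiset.toFinset_val, hnd.dedup] at h1
    exact h1

theorem OrthogonalFor.eval_pos {L : ℝ[X] →ₗ[ℝ] ℝ} (hL : PositiveFunctional L) {p : ℝ[X]}
    (ho : OrthogonalFor L p) (hp : p.Monic) {y : ℝ} (hy : 1 < y) : 0 < p.eval y := by
  obtain ⟨z, -, hz, h⟩ := ho.exists_roots hL hp rfl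
  rw [h, eval_prod]
  refine Finset.prod_pos fun i _ => ?_
  rw [eval_sub, eval_X, eval_C]
  linarith [(hz i).2]

/-! ### Division by a linear factor and moments against 1/(y - x) -/

theorem exists_eq_sub_mul_add (p : ℝ[X]) (c : ℝ) :
    ∃ k : ℝ[X], p = (X - C c) * k + C (p.eval c) ∧ (p ≠ 0 → k.degree < p.degree) ∧
      (p.Monic → 0 < p.natDegree → k.Monic) ∧ k.natDegree = p.natDegree - 1 := by
  refine ⟨p /ₘ (X - C c), ?_, fun h => ?_, fun h h' => ?_, ?_⟩
  · rw [← modByMonic_X_sub_C_eq_C_eval, add_comm, modByMonic_add_div]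
  · exact degree_divByMonic_lt _ (X - C c) h (by simp)
  · rw [Monic, leadingCoeff_divByMonic_of_monic (monic_X_sub_C c)]
    · exact h
    · rw [degree_X_sub_C, degree_eq_natDegree h.ne_zero]
      exact_mod_cast h'
  · rw [natDegree_divByMonic _ (monic_X_sub_C c), natDegree_X_sub_C]

/-- Write g = (x - y)k + g(y); the hypothesis kills the first term. It serves both the point y = 3
outside the interval and a zero of q inside it. -/
theorem map_mul_eq_eval_mul (L : ℝ[X] →ₗ[ℝ] ℝ) (r g : ℝ[X]) (y : ℝ)
    (h : ∀ k : ℝ[X], k.degree < g.degree → L ((X - C y) * (r * k)) = 0) :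
    L (r * g) = g.eval y * L r := by
  rcases eq_or_ne g 0 with rfl | hg
  · simp
  obtain ⟨k, hk, hd, -, -⟩ := exists_eq_sub_mul_add g y
  have : r * g = (X - C y) * (r * k) + g.eval y • r := by
    conv_lhs => rw [hk]
    rw [smul_eq_C_mul]
    ring
  rw [this, map_add, h k (hd hg), map_smul, zero_add, smul_eq_mul]

/-- If `p` is orthogonal for the weight `y - x`, then `L (p * g) = g(y) L(p)`. -/
theorem OrthogonalFor.map_mul_eq {L : ℝ[X] →ₗ[ℝ] ℝ} {p g : ℝ[X]} {y : ℝ}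
    (ho : OrthogonalFor (weightedFunctional L (C y - X)) p) (hg : g.degree ≤ p.degree) :
    L (p * g) = g.eval y * L p := by
  refine map_mul_eq_eval_mul L p g y fun k hk => ?_
  have h := ho k (hk.trans_le hg)
  rw [weightedFunctional_apply] at h
  rw [← neg_sub, neg_mul, map_neg, h, neg_zero]

theorem sub_X_nonneg {y : ℝ} (hy : 1 < y) :
    (C y - X : ℝ[X]) ≠ 0 ∧ ∀ x ∈ Set.Icc (-1 : ℝ) 1, 0 ≤ (C y - X : ℝ[X]).eval x := by
  refine ⟨fun h => ?_, fun x hx => ?_⟩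
  · have := congrArg (eval 1) h
    simp at this
    linarith
  · simp
    linarith [hx.2]

theorem one_sub_X_sq_nonneg :
    (1 - X ^ 2 : ℝ[X]) ≠ 0 ∧ ∀ x ∈ Set.Icc (-1 : ℝ) 1, 0 ≤ (1 - X ^ 2 : ℝ[X]).eval x := by
  refine ⟨fun h => ?_, fun x hx => ?_⟩
  · have := congrArg (eval 0) h
    simp at this
  · rw [eval_sub, eval_one, eval_pow, eval_X]
    nlinarith [hx.1, hx.2]

/-- The moment of a monic orthogonal polynomial against `1 / (y - x)` is positive. -/
theorem OrthogonalFor.map_pos {L : ℝ[X] →ₗ[ℝ] ℝ} (hL : PositiveFunctional L) {p : ℝ[X]} {y : ℝ}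
    (hy : 1 < y) (ho : OrthogonalFor (weightedFunctional L (C y - X)) p) (hp : p.Monic) :
    0 < L p := by
  -- With g = p this reads L(p²) = p(y) L(p), where L(p²) and p(y) are positive.
  have h1 := ho.map_mul_eq le_rfl
  have h2 := hL.self_pos hp.ne_zero
  have h3 := ho.eval_pos (hL.weighted (sub_X_nonneg hy).1 (sub_X_nonneg hy).2) hp hy
  rw [h1] at h2
  exact pos_of_mul_pos_right h2 h3.le

/-! ### The sign of p at the zeros of q -/

/-- Let `p` of degree `m + 1` be orthogonal for the weight `3 - x` and `q` of degree `m` for the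
weight `1 - x ^ 2`. At a zero of `q`, the values of `p` and of `q'` have opposite signs. -/
theorem eval_mul_eval_neg {M : ℝ[X] →ₗ[ℝ] ℝ} (hM : PositiveFunctional M) {p q l : ℝ[X]} {w : ℝ}
    (hp : p.Monic) (hq : q.Monic) (hpq : p.natDegree = q.natDegree + 1)
    (hop : OrthogonalFor (weightedFunctional M (C 3 - X)) p)
    (hoq : OrthogonalFor (weightedFunctional M (1 - X ^ 2)) q)
    (hl : q = (X - C w) * l) : p.eval w * l.eval w < 0 := by
  set N := weightedFunctional M (1 - X ^ 2) with hNdef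
  have hN : PositiveFunctional N := hM.weighted one_sub_X_sq_nonneg.1 one_sub_X_sq_nonneg.2
  have hlm : l.Monic := (monic_X_sub_C w).of_mul_monic_left (hl ▸ hq)
  have hql : q.natDegree = l.natDegree + 1 := by
    rw [hl, (monic_X_sub_C w).natDegree_mul hlm, natDegree_X_sub_C, add_comm]
  have hdp : p.degree = ((l.natDegree + 2 : ℕ) : WithBot ℕ) := by
    rw [degree_eq_natDegree hp.ne_zero, hpq, hql]
  have hdq : q.degree = ((l.natDegree + 1 : ℕ) : WithBot ℕ) := by
    rw [degree_eq_natDegree hq.ne_zero, hql]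
  have hdl : l.degree = ((l.natDegree : ℕ) : WithBot ℕ) := degree_eq_natDegree hlm.ne_zero
  -- the sign of `N (p * l)`
  have hl3 : 0 < l.eval 3 := by
    have h := hoq.eval_pos hN hq (y := 3) (by norm_num)
    rw [hl, eval_mul, eval_sub, eval_X, eval_C] at h
    have hw := (hoq.root_mem hN hq.ne_zero (a := w) (by rw [IsRoot, hl]; simp)).2
    exact pos_of_mul_pos_right h (by linarith)
  have h1 : N (p * l) < 0 := by
    -- The constant -8 is the value of 1 - x² at 3, the remainder on division by 3 - x.
    have e : (1 - X ^ 2 : ℝ[X]) * (p * l) =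
        (C 3 - X) * (p * ((X + C 3) * l)) + (-8 : ℝ) • (p * l) := by
      rw [smul_eq_C_mul]
      have h3 : (C 3 : ℝ[X]) = 3 := rfl
      have h8 : (C (-8) : ℝ[X]) = -8 := by rw [C_neg]; rfl
      rw [h3, h8]
      ring
    have h0 := hop ((X + C 3) * l) (by
      rw [degree_mul, degree_X_add_C, hdl, hdp]
      exact_mod_cast (by omega : 1 + l.natDegree < l.natDegree + 2))
    rw [weightedFunctional_apply] at h0
    rw [hNdef, weightedFunctional_apply, e, map_add, map_smul, h0, zero_add,
      hop.map_mul_eq (by rw [hdl, hdp]; exact_mod_cast (by omega)), smul_eq_mul]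
    have := mul_pos hl3 (hop.map_pos hM (by norm_num) hp)
    linarith
  -- the Gauss quadrature argument
  have h2 : N (l * l) = l.eval w * N l := by
    refine map_mul_eq_eval_mul N l l w fun k hk => ?_
    rw [← mul_assoc, ← hl]
    refine hoq k (hk.trans ?_)
    rw [hdl, hdq]
    exact_mod_cast Nat.lt_succ_self _
  obtain ⟨t, ht, -, htm, htd⟩ := exists_eq_sub_mul_add p w
  have htm := htm hp (by omega)
  -- Here p * l = q * t + p(w) l with t monic of the same degree as q, so t may be replaced by q
  -- under N(q · ).
  have h3 : N (p * l) = N (q * q) + p.eval w * N l := by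
    have hd : (t - q).degree < q.degree := by
      have := degree_sub_lt_left (p := t) (q := q) (by
        rw [degree_eq_natDegree htm.ne_zero, hdq, htd, hpq, hql]; rfl) htm.ne_zero
        (by rw [htm.leadingCoeff, hq.leadingCoeff])
      rwa [degree_eq_natDegree htm.ne_zero, htd, hpq, Nat.add_sub_cancel,
        ← degree_eq_natDegree hq.ne_zero] at this
    have e : p * l = q * (t - q) + q * q + p.eval w • l := by
      conv_lhs => rw [ht]
      rw [smul_eq_C_mul, add_mul, mul_right_comm, ← hl]
      ring
    rw [e, map_add, map_add, hoq _ hd, zero_add, map_smul, smul_eq_mul]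
  have h4 := hN.self_pos hq.ne_zero
  have h5 := hN.self_pos hlm.ne_zero
  rw [h2] at h5
  have h6 : p.eval w * N l < 0 := by linarith
  -- Multiplying l(w) N(l) > 0 by p(w) N(l) < 0 eliminates the unknown sign of N(l).
  by_contra! H
  nlinarith [mul_nonneg H (mul_self_nonneg (N l)), mul_neg_of_pos_of_neg h5 h6]

/-! ### From signs to interlacing -/

theorem neg_one_pow_mul_prod_pos {ι : Type*} (s : Finset ι) (z : ι → ℝ) (x : ℝ)
    (hx : ∀ i ∈ s, x ≠ z i) :
    0 < (-1 : ℝ) ^ (s.filter fun i => x < z i).card * ∏ i ∈ s, (x - z i) := by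
  classical
  induction s using Finset.induction_on with
  | empty => simp
  | insert a s ha ih =>
    have h := ih fun i hi => hx i (Finset.mem_insert_of_mem hi)
    have hxa := hx a (Finset.mem_insert_self a s)
    rw [Finset.prod_insert ha, Finset.filter_insert]
    split_ifs with hlt
    · rw [Finset.card_insert_of_notMem (by simp [ha]), pow_succ]
      have := mul_pos (sub_pos.2 hlt) h
      linarith
    · have := mul_pos (sub_pos.2 (lt_of_le_of_ne (not_lt.1 hlt) (Ne.symm hxa))) h
      linarith

theorem odd_card_of_prod_neg {ι κ : Type*} (s : Finset ι) (t : Finset κ) (z : ι → ℝ) (w : κ → ℝ)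
    (x : ℝ) (h : (∏ i ∈ s, (x - z i)) * ∏ i ∈ t, (x - w i) < 0) :
    Odd ((s.filter fun i => x < z i).card + (t.filter fun i => x < w i).card) := by
  have h0 := mul_ne_zero_iff.1 h.ne
  have h1 := neg_one_pow_mul_prod_pos s z x fun i hi e =>
    h0.1 (Finset.prod_eq_zero hi (sub_eq_zero.2 e))
  have h2 := neg_one_pow_mul_prod_pos t w x fun i hi e =>
    h0.2 (Finset.prod_eq_zero hi (sub_eq_zero.2 e))
  by_contra H
  have h3 := mul_pos h1 h2
  rw [mul_mul_mul_comm, ← pow_add, (Nat.not_odd_iff_even.1 H).neg_one_pow, one_mul] at h3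
  linarith

theorem StrictMono.lt_iff_card_filter {n : ℕ} {z : Fin n → ℝ} (hz : StrictMono z) (x : ℝ)
    (i : Fin n) :
    x < z i ↔ n - (i : ℕ) ≤ (Finset.univ.filter fun j => x < z j).card := by
  constructor
  · intro h
    rw [← Fin.card_Ici]
    refine Finset.card_le_card fun j hj => ?_
    simp only [Finset.mem_filter, Finset.mem_univ, true_and]
    exact h.trans_le (hz.monotone (Finset.mem_Ici.1 hj))
  · intro h
    by_contra! H
    have hsub : (Finset.univ.filter fun j => x < z j) ⊆ Finset.Ioi i := fun j hj => by
      rw [Finset.mem_Ioi]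
      exact hz.lt_iff_lt.1 (H.trans_lt (Finset.mem_filter.1 hj).2)
    have := Finset.card_le_card hsub
    rw [Fin.card_Ioi] at this
    omega

/-- Two strictly increasing sequences interlace if at each `w i` the monic polynomial with zeros
`z` and the derivative of the monic polynomial with zeros `w` have opposite signs. -/
theorem interlace_of_prod_neg {m : ℕ} {z : Fin (m + 1) → ℝ} {w : Fin m → ℝ} (hz : StrictMono z)
    (hw : StrictMono w)
    (h : ∀ i, (∏ j, (w i - z j)) * ∏ j ∈ Finset.univ.erase i, (w i - w j) < 0) (i : Fin m) :
    z i.castSucc < w i ∧ w i < z i.succ := by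
  -- The goal amounts to A i = m - i: exactly the zeros z with index above i exceed w i.
  set A : Fin m → ℕ := fun i => (Finset.univ.filter fun j => w i < z j).card with hA
  have hodd : ∀ i, Odd (A i + (m - 1 - i)) := fun i => by
    have h1 := odd_card_of_prod_neg _ _ _ _ _ (h i)
    have h2 : ((Finset.univ.erase i).filter fun j => w i < w j) = Finset.Ioi i := by
      ext j
      simp only [Finset.mem_filter, Finset.mem_erase, Finset.mem_univ, and_true, Finset.mem_Ioi,
        hw.lt_iff_lt]
      exact ⟨fun h => h.2, fun h => ⟨h.ne', h⟩⟩
    rwa [h2, Fin.card_Ioi] at h1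
  have hanti : ∀ i j : Fin m, i ≤ j → A j ≤ A i := fun i j hij =>
    Finset.card_le_card fun k hk => by
      simp only [Finset.mem_filter, Finset.mem_univ, true_and] at hk ⊢
      exact (hw.monotone hij).trans_lt hk
  -- The parity of A alternates with i, so A, which is antitone, drops strictly.
  have hstep : ∀ (i : ℕ) (hi : i + 1 < m), A ⟨i + 1, hi⟩ < A ⟨i, by omega⟩ := fun i hi => by
    refine lt_of_le_of_ne (hanti _ _ (by simp)) fun e => ?_
    have h1 := hodd ⟨i, by omega⟩
    have h2 := hodd ⟨i + 1, hi⟩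
    rw [e] at h2
    rw [Nat.odd_iff] at h1 h2
    simp only at h1 h2
    omega
  -- Induction down from the last index, where A is odd and hence at least 1.
  have hlow : ∀ (k i : ℕ) (hi : i < m), i + k + 1 = m → k + 1 ≤ A ⟨i, hi⟩ := by
    intro k
    induction k with
    | zero =>
      intro i hi hk
      have h1 := hodd ⟨i, hi⟩
      rw [Nat.odd_iff] at h1
      simp only at h1
      omega
    | succ k ih =>
      intro i hi hk
      have h1 := ih (i + 1) (by omega) (by omega)
      have h2 := hstep i (by omega)
      omega
  -- At i = 0 parity excludes the value m + 1, so A is at most m; strict decrease does the rest.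
  have hupp : ∀ (i : ℕ) (hi : i < m), A ⟨i, hi⟩ + i ≤ m := by
    intro i
    induction i with
    | zero =>
      intro hi
      have h1 := hodd ⟨0, hi⟩
      have h2 : A ⟨0, hi⟩ ≤ m + 1 := by
        simpa using Finset.card_le_univ (Finset.univ.filter fun j => w ⟨0, hi⟩ < z j)
      rw [Nat.odd_iff] at h1
      simp only at h1
      omega
    | succ i ih =>
      intro hi
      have h1 := ih (by omega)
      have h2 := hstep i hi
      omega
  have h1 := hlow (m - 1 - i) i i.2 (by omega)
  have h2 := hupp i i.2
  simp only [Fin.eta] at h1 h2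
  have hne : w i ≠ z i.castSucc := fun e =>
    (h i).ne (mul_eq_zero_of_left (Finset.prod_eq_zero (f := fun j => w i - z j)
      (Finset.mem_univ i.castSucc) (sub_eq_zero.2 e)) _)
  constructor
  · refine lt_of_le_of_ne (not_lt.1 fun hlt => ?_) hne.symm
    have := (hz.lt_iff_card_filter (w i) i.castSucc).1 hlt
    simp only [Fin.val_castSucc] at this
    change _ ≤ A i at this
    omega
  · refine (hz.lt_iff_card_filter (w i) i.succ).2 ?_
    change _ ≤ A i
    simp only [Fin.val_succ]
    omega

/-! ### Interlacing of zeros with multiplicity -/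

theorem exists_interlacing_roots {M : ℝ[X] →ₗ[ℝ] ℝ} (hM : PositiveFunctional M) {p q : ℝ[X]}
    {m : ℕ} (hp : p.Monic) (hq : q.Monic) (hpd : p.natDegree = m + 1) (hqd : q.natDegree = m)
    (hop : OrthogonalFor (weightedFunctional M (C 3 - X)) p)
    (hoq : OrthogonalFor (weightedFunctional M (1 - X ^ 2)) q) :
    ∃ (z : Fin (m + 1) → ℝ) (w : Fin m → ℝ),
      (Function.Injective z ∧ (∀ i, z i ∈ Set.Icc (-1 : ℝ) 1) ∧ p = ∏ i, (X - C (z i))) ∧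
      (Function.Injective w ∧ (∀ i, w i ∈ Set.Icc (-1 : ℝ) 1) ∧ q = ∏ i, (X - C (w i))) ∧
      ∀ i : Fin m, z i.castSucc < w i ∧ w i < z i.succ := by
  have h3 := sub_X_nonneg (y := 3) (by norm_num)
  obtain ⟨z, hz, hz', hpz⟩ := hop.exists_roots (hM.weighted h3.1 h3.2) hp hpd
  obtain ⟨w, hw, hw', hqw⟩ := hoq.exists_roots
    (hM.weighted one_sub_X_sq_nonneg.1 one_sub_X_sq_nonneg.2) hq hqd
  refine ⟨z, w, ⟨hz.injective, fun i => Set.Ioo_subset_Icc_self (hz' i), hpz⟩,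
    ⟨hw.injective, fun i => Set.Ioo_subset_Icc_self (hw' i), hqw⟩,
    interlace_of_prod_neg hz hw fun i => ?_⟩
  have h := eval_mul_eval_neg hM (l := ∏ j ∈ Finset.univ.erase i, (X - C (w j))) (w := w i)
    hp hq (by omega) hop hoq
    (by rw [hqw]; exact (Finset.mul_prod_erase _ _ (Finset.mem_univ i)).symm)
  rw [hpz, eval_prod, eval_prod] at h
  simpa only [eval_sub, eval_X, eval_C] using h

/-- Agreement with c * p is needed only near [-1, 1]; the restriction x < 3 avoids the quotient
defining the kernel at x = 3. -/
theorem listsZeros_of_eqOn {F : ℝ → ℝ} {p : ℝ[X]} {c : ℝ} {n : ℕ} {z : Fin n → ℝ} (hc : c ≠ 0)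
    (hF : ∀ x < 3, F x = c * p.eval x)
    (hz : Function.Injective z ∧ (∀ i, z i ∈ Set.Icc (-1 : ℝ) 1) ∧ p = ∏ i, (X - C (z i))) :
    ListsZeros F (Set.Icc (-1) 1) z := by
  obtain ⟨hinj, hmem, hp⟩ := hz
  have hev : ∀ x ∈ Set.Icc (-1 : ℝ) 1, F =ᶠ[nhds x] fun y => c * p.eval y := fun x hx => by
    filter_upwards [Iio_mem_nhds (show x < 3 by linarith [hx.2])] with y hy using hF y hy
  have han : ∀ (r : ℝ[X]) (x : ℝ), AnalyticAt ℝ (fun y => c * r.eval y) x := fun r x =>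
    analyticAt_const.mul (AnalyticOnNhd.eval_polynomial r x trivial)
  refine ⟨fun x hx => (han p x).congr (hev x hx).symm, hmem, fun x hx => ?_⟩
  rw [analyticOrderAt_congr (hev x hx)]
  by_cases hxz : ∃ i, z i = x
  · obtain ⟨i, rfl⟩ := hxz
    have hs : {j | z j = z i} = {i} := by
      ext j
      simp [hinj.eq_iff]
    rw [hs, Set.ncard_singleton, (han p _).analyticOrderAt_eq_natCast]
    refine ⟨fun y => c * (∏ j ∈ Finset.univ.erase i, (X - C (z j))).eval y, han _ _, ?_, ?_⟩
    · refine mul_ne_zero hc ?_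
      rw [eval_prod, Finset.prod_ne_zero_iff]
      intro j hj
      rw [eval_sub, eval_X, eval_C, sub_ne_zero]
      exact fun e => (Finset.mem_erase.1 hj).1 (hinj e).symm
    · refine Filter.Eventually.of_forall fun y => ?_
      rw [hp, ← Finset.mul_prod_erase _ _ (Finset.mem_univ i)]
      simp only [eval_mul, eval_sub, eval_X, eval_C, smul_eq_mul]
      ring
  · have hs : {j | z j = x} = ∅ := by
      ext j
      simpa using fun h => hxz ⟨j, h⟩
    rw [hs, Set.ncard_empty, Nat.cast_zero, (han p x).analyticOrderAt_eq_zero]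
    refine mul_ne_zero hc ?_
    rw [hp, eval_prod, Finset.prod_ne_zero_iff]
    intro j _
    rw [eval_sub, eval_X, eval_C, sub_ne_zero]
    exact fun e => hxz ⟨j, e.symm⟩

/-- Orthogonal polynomials for the weights `3 - x` and `1 - x ^ 2` relative to the same positive
functional, of consecutive degrees, interlace. -/
theorem strictlyInterlaces_of_orthogonal {M : ℝ[X] →ₗ[ℝ] ℝ} (hM : PositiveFunctional M)
    {p q : ℝ[X]} {m : ℕ} (hp : p.Monic) (hq : q.Monic) (hpd : p.natDegree = m + 1)
    (hqd : q.natDegree = m) (hop : OrthogonalFor (weightedFunctional M (C 3 - X)) p)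
    (hoq : OrthogonalFor (weightedFunctional M (1 - X ^ 2)) q) {F G : ℝ → ℝ} {c d : ℝ}
    (hc : c ≠ 0) (hd : d ≠ 0) (hF : ∀ x < 3, F x = c * p.eval x)
    (hG : ∀ x < 3, G x = d * q.eval x) :
    StrictlyInterlaces F G (Set.Icc (-1) 1) := by
  obtain ⟨z, w, hz, hw, h⟩ := exists_interlacing_roots hM hp hq hpd hqd hop hoq
  exact Or.inr ⟨m, z, w, listsZeros_of_eqOn hc hF hz, listsZeros_of_eqOn hd hG hw, h⟩

/-! ### Functionals given by Jacobi weights -/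

/-- The functional `f ↦ ∫_{-1}^{1} f(x) w(x) dx` on real polynomials. -/
noncomputable def integralFunctional (w : ℝ → ℝ)
    (hw : IntervalIntegrable w MeasureTheory.volume (-1) 1) : ℝ[X] →ₗ[ℝ] ℝ where
  toFun f := ∫ x in (-1 : ℝ)..1, f.eval x * w x
  map_add' f g := by
    rw [← intervalIntegral.integral_add (hw.continuousOn_mul f.continuous.continuousOn)
      (hw.continuousOn_mul g.continuous.continuousOn)]
    simp only [eval_add, add_mul]
  map_smul' c f := by
    simp only [eval_smul, smul_eq_mul, mul_assoc, RingHom.id_apply,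
      intervalIntegral.integral_const_mul]

theorem integralFunctional_positive {w : ℝ → ℝ}
    (hw : IntervalIntegrable w MeasureTheory.volume (-1) 1)
    (hpos : ∀ x ∈ Set.Ioo (-1 : ℝ) 1, 0 < w x) : PositiveFunctional (integralFunctional w hw) := by
  intro f hf hf0
  have hae : ∀ᵐ x ∂MeasureTheory.volume.restrict (Set.uIoc (-1 : ℝ) 1), x ∈ Set.Ioo (-1 : ℝ) 1 := by
    rw [Set.uIoc_of_le (by norm_num), ← MeasureTheory.restrict_Ioo_eq_restrict_Ioc]
    exact MeasureTheory.ae_restrict_mem measurableSet_Ioo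
  change 0 < ∫ x in (-1 : ℝ)..1, f.eval x * w x
  rw [intervalIntegral.integral_pos_iff_support_of_nonneg_ae' ?_
    (hw.continuousOn_mul f.continuous.continuousOn)]
  · refine ⟨by norm_num, ?_⟩
    have hsub : Set.Ioo (-1 : ℝ) 1 \ (f.roots.toFinset : Set ℝ) ⊆
        Function.support (fun x => f.eval x * w x) ∩ Set.Ioc (-1) 1 := by
      rintro x ⟨hx, hr⟩
      have hfx : f.eval x ≠ 0 := fun h => hr (by simpa [hf] using h)
      exact ⟨mul_ne_zero hfx (hpos x hx).ne', hx.1, hx.2.le⟩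
    refine lt_of_lt_of_le ?_ (MeasureTheory.measure_mono hsub)
    rw [MeasureTheory.measure_sdiff_null (Finset.measure_zero _ _)]
    simp
  · filter_upwards [hae] with x hx
    exact mul_nonneg (hf0 x (Set.Ioo_subset_Icc_self hx)) (hpos x hx).le

theorem weighted_integralFunctional {w v : ℝ → ℝ}
    (hw : IntervalIntegrable w MeasureTheory.volume (-1) 1)
    (hv : IntervalIntegrable v MeasureTheory.volume (-1) 1) {h : ℝ[X]}
    (hwv : ∀ x ∈ Set.Icc (-1 : ℝ) 1, h.eval x * w x = v x) :
    weightedFunctional (integralFunctional w hw) h = integralFunctional v hv := by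
  refine LinearMap.ext fun f => ?_
  change ∫ x in (-1 : ℝ)..1, (h * f).eval x * w x = ∫ x in (-1 : ℝ)..1, f.eval x * v x
  refine intervalIntegral.integral_congr fun x hx => ?_
  rw [Set.uIcc_of_le (by norm_num)] at hx
  simp only [eval_mul]
  rw [← hwv x hx]
  ring

theorem jacobiWeight_pos {α β x : ℝ} (hx : x ∈ Set.Ioo (-1 : ℝ) 1) : 0 < jacobiWeight α β x :=
  mul_pos (Real.rpow_pos_of_pos (by linarith [hx.2]) _)
    (Real.rpow_pos_of_pos (by linarith [hx.1]) _)

theorem one_sub_sq_mul_jacobiWeight {α β x : ℝ} (hα : -1 < α) (hβ : -1 < β)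
    (hx : x ∈ Set.Icc (-1 : ℝ) 1) :
    (1 - x ^ 2) * jacobiWeight α β x = jacobiWeight (α + 1) (β + 1) x := by
  unfold jacobiWeight
  -- At an endpoint both sides are 0, because the exponents α + 1 and β + 1 are nonzero.
  rcases eq_or_lt_of_le hx.1 with rfl | h1
  · simp [Real.zero_rpow (show β + 1 ≠ 0 by linarith)]
  rcases eq_or_lt_of_le hx.2 with rfl | h2
  · simp [Real.zero_rpow (show α + 1 ≠ 0 by linarith)]
  rw [Real.rpow_add_one (by linarith), Real.rpow_add_one (by linarith)]
  ring

theorem jacobiP_orthogonalFor {α β : ℝ} (hα : -1 < α) (hβ : -1 < β) (n : ℕ) :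
    OrthogonalFor (integralFunctional _ (jacobiWeight_intervalIntegrable hα hβ))
      (jacobiP α β n) := by
  obtain ⟨hm, hd, ho⟩ := jacobiP_spec hα hβ n
  intro g hg
  rw [degree_eq_natDegree hm.ne_zero, hd] at hg
  rw [← ho g hg]
  change ∫ x in (-1 : ℝ)..1, _ = ∫ x in (-1 : ℝ)..1, _
  simp only [eval_mul]

theorem jacobiP_degree (α β : ℝ) (n : ℕ) : (jacobiP α β n).degree = n := by
  rw [degree_eq_natDegree (jacobiP_monic_natDegree α β n).1.ne_zero,
    (jacobiP_monic_natDegree α β n).2]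

theorem jacobiP_eval_pos {α β : ℝ} (hα : -1 < α) (hβ : -1 < β) (n : ℕ) {y : ℝ} (hy : 1 < y) :
    0 < (jacobiP α β n).eval y :=
  (jacobiP_orthogonalFor hα hβ n).eval_pos
    (integralFunctional_positive _ fun _ hx => jacobiWeight_pos hx)
    (jacobiP_monic_natDegree α β n).1 hy

theorem jacobiP_sub_monic (α β : ℝ) (n : ℕ) (c : ℝ) :
    (jacobiP α β (n + 1) - C c * jacobiP α β n).Monic ∧
      (jacobiP α β (n + 1) - C c * jacobiP α β n).natDegree = n + 1 := by
  have hd : (C c * jacobiP α β n).degree < (jacobiP α β (n + 1)).degree := by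
    rw [← smul_eq_C_mul]
    refine (degree_smul_le _ _).trans_lt ?_
    rw [jacobiP_degree, jacobiP_degree]
    exact_mod_cast Nat.lt_succ_self n
  refine ⟨(jacobiP_monic_natDegree α β (n + 1)).1.sub_of_left hd,
    natDegree_eq_of_degree_eq_some ?_⟩
  rw [degree_sub_eq_left_of_degree_lt hd, jacobiP_degree]

/-! ### The kernel polynomial S -/

theorem jacobiS_strictlyInterlaces {α β : ℝ} (hα : 0 < α) (hβ : 0 < β) (n : ℕ) :
    StrictlyInterlaces (jacobiS α β n) (fun x => (jacobiP α β n).eval x) (Set.Icc (-1) 1) := by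
  obtain ⟨a, rfl⟩ : ∃ a, α = a + 1 := ⟨α - 1, by ring⟩
  obtain ⟨b, rfl⟩ : ∃ b, β = b + 1 := ⟨β - 1, by ring⟩
  have ha : -1 < a := by linarith
  have hb : -1 < b := by linarith
  have hint := jacobiWeight_intervalIntegrable ha hb
  have hint' := jacobiWeight_intervalIntegrable (α := a + 1) (β := b + 1)
    (by linarith) (by linarith)
  set u := (jacobiP a b (n + 1)).eval 3 with hu
  set v := (jacobiP a b (n + 2)).eval 3 with hv
  have hu0 : u ≠ 0 := (jacobiP_eval_pos ha hb _ (by norm_num)).ne'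
  -- The coefficient v / u makes T vanish at 3, so k = T / (x - 3) is a polynomial, and S = u k away
  -- from 3.
  obtain ⟨hTm, hTd⟩ := jacobiP_sub_monic a b (n + 1) (v / u)
  set T := jacobiP a b (n + 1 + 1) - C (v / u) * jacobiP a b (n + 1) with hT
  obtain ⟨k, hk, -, hkm, hkd⟩ := exists_eq_sub_mul_add T 3
  have hT3 : T.eval 3 = 0 := by
    rw [hT, eval_sub, eval_mul, eval_C, ← hu, div_mul_cancel₀ _ hu0]
    exact sub_self v
  rw [hT3, C_0, add_zero] at hk
  have hkm := hkm hTm (by omega)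
  refine strictlyInterlaces_of_orthogonal (M := integralFunctional _ hint) (p := k)
    (q := jacobiP (a + 1) (b + 1) n) (c := u) (d := 1)
    (integralFunctional_positive _ fun _ hx => jacobiWeight_pos hx)
    hkm (jacobiP_monic_natDegree _ _ n).1 (by omega) (jacobiP_monic_natDegree _ _ n).2
    ?_ ?_ hu0 one_ne_zero (fun x hx => ?_) (fun x _ => (one_mul _).symm)
  · intro g hg
    rw [degree_eq_natDegree hkm.ne_zero, hkd, hTd, Nat.add_sub_cancel] at hg
    -- Multiplying k by 3 - x restores -T, whose two terms are orthogonal to everything of degree at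
    -- most n.
    have e : (C 3 - X) * (k * g) =
        (v / u) • (jacobiP a b (n + 1) * g) - jacobiP a b (n + 1 + 1) * g := by
      have : (C 3 - X) * (k * g) = -(T * g) := by
        rw [hk]
        ring
      rw [this, hT, smul_eq_C_mul]
      ring
    rw [weightedFunctional_apply, e, map_sub, map_smul,
      jacobiP_orthogonalFor ha hb (n + 1) g (by rwa [jacobiP_degree]),
      jacobiP_orthogonalFor ha hb (n + 1 + 1) g (by
        rw [jacobiP_degree]
        exact hg.trans (by exact_mod_cast Nat.lt_succ_self _)), smul_zero, sub_zero]
  · rw [weighted_integralFunctional hint hint' fun x hx => by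
      rw [eval_sub, eval_one, eval_pow, eval_X, one_sub_sq_mul_jacobiWeight ha hb hx]]
    exact jacobiP_orthogonalFor (by linarith) (by linarith) n
  · have hx3 : x - 3 ≠ 0 := by linarith
    have hTx := congrArg (eval x) hk
    simp only [hT, eval_mul, eval_sub, eval_X, eval_C] at hTx
    unfold jacobiS jacobiK
    simp only [add_sub_cancel_right]
    rw [← hu, div_eq_iff hx3, mul_assoc, mul_comm (k.eval x), ← hTx]
    change _ - v * _ = _
    field_simp

/-! ### The combination R and the weight divided by 3 - x -/

theorem jacobiWeight_div_intervalIntegrable {α β : ℝ} (hα : -1 < α) (hβ : -1 < β) :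
    IntervalIntegrable (fun x => jacobiWeight α β x / (3 - x)) MeasureTheory.volume (-1) 1 := by
  simp only [div_eq_mul_inv]
  refine (jacobiWeight_intervalIntegrable hα hβ).mul_continuousOn ?_
  refine ContinuousOn.inv₀ (by fun_prop) fun x hx => ?_
  rw [Set.uIcc_of_le (by norm_num)] at hx
  linarith [hx.2]

/-- The functional of integration against the Jacobi weight divided by `3 - x`. -/
noncomputable def jacobiDivFunctional {α β : ℝ} (hα : -1 < α) (hβ : -1 < β) : ℝ[X] →ₗ[ℝ] ℝ :=
  integralFunctional _ (jacobiWeight_div_intervalIntegrable hα hβ)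

theorem jacobiDivFunctional_positive {α β : ℝ} (hα : -1 < α) (hβ : -1 < β) :
    PositiveFunctional (jacobiDivFunctional hα hβ) :=
  integralFunctional_positive _ fun x hx =>
    div_pos (jacobiWeight_pos hx) (by linarith [hx.2])

theorem jacobiP_orthogonalFor_div {α β : ℝ} (hα : -1 < α) (hβ : -1 < β) (n : ℕ) :
    OrthogonalFor (weightedFunctional (jacobiDivFunctional hα hβ) (C 3 - X)) (jacobiP α β n) := by
  unfold jacobiDivFunctional
  rw [weighted_integralFunctional _ (jacobiWeight_intervalIntegrable hα hβ) fun x hx => by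
    rw [eval_sub, eval_C, eval_X, mul_div_cancel₀]
    linarith [hx.2]]
  exact jacobiP_orthogonalFor hα hβ n

/-- Reading λ as a moment against 1/(3 - s) makes `OrthogonalFor.map_pos` and
`OrthogonalFor.map_mul_eq` applicable to it. -/
theorem jacobiLam_eq {α β : ℝ} (hα : -1 < α + 1) (hβ : -1 < β + 1) (n : ℕ) :
    jacobiLam α β n = jacobiDivFunctional hα hβ (jacobiP (α + 1) (β + 1) n) := by
  refine intervalIntegral.integral_congr fun x _ => ?_
  simp only [jacobiWeight]
  ring

theorem jacobiP_strictlyInterlaces_jacobiR {α β : ℝ} (hα : -1 < α) (hβ : -1 < β) (k : ℕ) :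
    StrictlyInterlaces (fun x => (jacobiP α β (k + 2)).eval x) (jacobiR α β (k + 1))
      (Set.Icc (-1) 1) := by
  have ha : -1 < α + 1 := by linarith
  have hb : -1 < β + 1 := by linarith
  have ho := jacobiP_orthogonalFor_div ha hb
  have hl : jacobiLam α β k ≠ 0 := by
    rw [jacobiLam_eq ha hb]
    exact ((ho k).map_pos (jacobiDivFunctional_positive ha hb) (by norm_num)
      (jacobiP_monic_natDegree _ _ k).1).ne'
  obtain ⟨hqm, hqd⟩ := jacobiP_sub_monic (α + 1) (β + 1) k (jacobiLam α β (k + 1) / jacobiLam α β k)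
  refine strictlyInterlaces_of_orthogonal (jacobiDivFunctional_positive hα hβ)
    (jacobiP_monic_natDegree α β (k + 2)).1 hqm (jacobiP_monic_natDegree α β (k + 2)).2 hqd
    (jacobiP_orthogonalFor_div hα hβ (k + 2)) ?_ one_ne_zero hl (fun x _ => (one_mul _).symm)
    (fun x _ => ?_)
  · have hN : weightedFunctional (jacobiDivFunctional hα hβ) (1 - X ^ 2) =
        jacobiDivFunctional ha hb :=
      weighted_integralFunctional _ _ fun x hx => by
        rw [eval_sub, eval_one, eval_pow, eval_X, ← mul_div_assoc,
          one_sub_sq_mul_jacobiWeight hα hβ hx]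
    rw [hN]
    intro g hg
    rw [degree_eq_natDegree hqm.ne_zero, hqd] at hg
    -- For deg g ≤ k the two products have moments g(3) λ_{k+1} and g(3) λ_k, which cancel with the
    -- ratio chosen above.
    rw [sub_mul, map_sub, mul_assoc, ← smul_eq_C_mul, map_smul,
      (ho (k + 1)).map_mul_eq (by rw [jacobiP_degree]; exact hg.le),
      (ho k).map_mul_eq (by rw [jacobiP_degree]; exact Order.lt_succ_iff.1 hg),
      ← jacobiLam_eq, ← jacobiLam_eq, smul_eq_mul]
    field_simp
    ring
  · rw [eval_sub, eval_mul, eval_C]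
    unfold jacobiR
    simp only [Nat.add_sub_cancel]
    field_simp

theorem mainTheorem4 :
    (∀ (α β : ℝ) (n : ℕ), 0 < α → 0 < β →
      StrictlyInterlaces (jacobiS α β n) (fun x => (jacobiP α β n).eval x) (Set.Icc (-1) 1)) ∧
    (∀ (α β : ℝ) (n : ℕ), -1 < α → -1 < β → 2 ≤ n →
      StrictlyInterlaces (fun x => (jacobiP α β n).eval x) (jacobiR α β (n - 1))
        (Set.Icc (-1) 1)) := by
  refine ⟨fun α β n hα hβ => jacobiS_strictlyInterlaces hα hβ n, fun α β n hα hβ hn => ?_⟩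
  obtain ⟨k, rfl⟩ := Nat.exists_eq_add_of_le' hn
  exact jacobiP_strictlyInterlaces_jacobiR hα hβ k
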